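/- Let $d\ge 2$ and let $\mathcal W$ be a quantum channel (a completely positive trace-preserving linear map) from a $d$-dimensional system (qudit) $A'$ to a system $B$ of arbitrary finite dimension. Let $\Phi_{AA'}=|\Phi\rangle\langle\Phi|$ with $|\Phi\rangle=\frac1{\sqrt d}\sum_{i=0}^{d-1}|i\rangle_A|i\rangle_{A'}$ denote an EPR pair. For a channel $\mathcal V_{A'\to B}$ with $d$-dimensional input, define the Rényi–Bhattacharyya parameter $$R(\mathcal V)=d^{\,H},\qquad H=2\log_d\ \sup_{\sigma_B}\operatorname{tr}\Big[\rho_{AB}^{1/2}\,\big(I_A\otimes\sigma_B^{1/2}\big)\Big],\qquad \rho_{AB}=(\mathrm{id}_A\otimes\mathcal V)(\Phi_{AA'}),$$ where the supremum is over all quantum states $\sigma_B$ (so $H$ is the conditional Petz–Rényi entropy $H^{\uparrow}_{1/2}(A|B)_\rho$). For a unitary $C$ on $\mathbb C^d\otimes\mathbb C^d$, the good channel $\mathcal W_C^{(1)}$, from $A'_2$ to $A_1B_1B_2$, is $$\mathcal W_C^{(1)}(\rho)=(\mathrm{id}_{A_1}\otimes\mathcal W\otimes\mathcal W)\Big((I_{A_1}\otimes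 C)\,(\Phi_{A_1A'_1}\otimes\rho)\,(I_{A_1}\otimes C)^\dagger\Big).$$ Let $\mathcal U$ be a finite set of unitaries on $\mathbb C^d\otimes\mathbb C^d$ that is a unitary 2-design, i.e. for every quantum channel $\mathcal T$ from the two-qudit system to itself and every two-qudit state $\rho$, $$\frac1{|\mathcal U|}\sum_{U\in\mathcal U}U^\dagger\,\mathcal T(U\rho U^\dagger)\,U=\int U^\dagger\,\mathcal T(U\rho U^\dagger)\,U\,d\eta(U),$$ where $\eta$ is the Haar probability measure on the unitary group $\mathcal U(d^2)$. If $C$ is chosen uniformly at random from $\mathcal U$, then $$\mathbb E_C\,R\big(\mathcal W_C^{(1)}\big)=\frac{d}{d^2+1}\big(1+R(\mathcal W)^2\big)\le R(\mathcal W),$$ and equality holds in the last inequality if and only if $R(\mathcal W)\in\{1/d,\,d\}$. -/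

import Mathlib

open scoped MatrixOrder Kronecker ComplexOrder

noncomputable section

namespace QuantumPolar

/-- The linear map `F ⊗ G` on matrices of a bipartite system, determined by
`(F ⊗ G)(X ⊗ Y) = F X ⊗ G Y`; it is written out on matrix units. -/
def tensorMap {A A' B B' : Type*} [Fintype A] [DecidableEq A] [Fintype A'] [DecidableEq A']
    (F : Matrix A A ℂ →ₗ[ℂ] Matrix B B ℂ) (G : Matrix A' A' ℂ →ₗ[ℂ] Matrix B' B' ℂ) :
    Matrix (A × A') (A × A') ℂ →ₗ[ℂ] Matrix (B × B') (B × B') ℂ where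
  toFun ρ := ∑ p : A × A', ∑ q : A × A',
    ρ p q • (F (Matrix.single p.1 q.1 1) ⊗ₖ G (Matrix.single p.2 q.2 1))
  map_add' ρ σ := by
    simp only [Matrix.add_apply, add_smul, Finset.sum_add_distrib]
  map_smul' c ρ := by
    simp only [Matrix.smul_apply, smul_eq_mul, mul_smul, Finset.smul_sum, RingHom.id_apply]

/-- A quantum state (density matrix): positive semidefinite with trace one. -/
def IsState {A : Type*} [Fintype A] (ρ : Matrix A A ℂ) : Prop :=
  ρ.PosSemidef ∧ ρ.trace = 1

/-- A quantum channel: a completely positive and trace-preserving linear map. -/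
def IsChannel {A B : Type*} [Fintype A] [DecidableEq A] [Fintype B]
    (W : Matrix A A ℂ →ₗ[ℂ] Matrix B B ℂ) : Prop :=
  (∀ (k : ℕ) (M : Matrix (Fin k × A) (Fin k × A) ℂ), M.PosSemidef →
      (tensorMap (LinearMap.id : Matrix (Fin k) (Fin k) ℂ →ₗ[ℂ] Matrix (Fin k) (Fin k) ℂ)
        W M).PosSemidef) ∧
    ∀ ρ : Matrix A A ℂ, (W ρ).trace = ρ.trace

/-- The conditional Petz-Rényi entropy of order `1/2` of a state `ρ` of `AB`, with logarithms in
base `d`: twice the logarithm of the supremum over the states `σ` of `B` of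
`tr (ρ^(1/2) (1 ⊗ σ^(1/2)))`. -/
def petzRenyiHalf (d : ℕ) {A B : Type*} [Fintype A] [DecidableEq A] [Fintype B] [DecidableEq B]
    (ρ : Matrix (A × B) (A × B) ℂ) : ℝ :=
  2 * Real.logb d (⨆ σ : {σ : Matrix B B ℂ // IsState σ},
    ((CFC.sqrt ρ * ((1 : Matrix A A ℂ) ⊗ₖ CFC.sqrt σ.1)).trace).re)

/-- The vector `(1 / √d) ∑ i, |i⟩|i⟩`. -/
def eprVector (d : ℕ) : Fin d × Fin d → ℂ :=
  fun p => if p.1 = p.2 then ((1 / Real.sqrt d : ℝ) : ℂ) else 0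

/-- The EPR pair `|Φ⟩⟨Φ|`. -/
def epr (d : ℕ) : Matrix (Fin d × Fin d) (Fin d × Fin d) ℂ :=
  Matrix.vecMulVec (eprVector d) (star (eprVector d))

/-- The Rényi-Bhattacharyya parameter of a channel `W` with qudit input: `d ^ H`, where `H` is the
entropy `petzRenyiHalf` of the state `(id ⊗ W)(Φ)`. -/
def renyiBhattacharyya {d : ℕ} {B : Type*} [Fintype B] [DecidableEq B]
    (W : Matrix (Fin d) (Fin d) ℂ →ₗ[ℂ] Matrix B B ℂ) : ℝ :=
  (d : ℝ) ^ petzRenyiHalf d (tensorMap (LinearMap.id :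
    Matrix (Fin d) (Fin d) ℂ →ₗ[ℂ] Matrix (Fin d) (Fin d) ℂ) W (epr d))

/-- The good channel, from `A'₂` to `A₁ B₁ B₂`:
`ρ ↦ (id ⊗ W ⊗ W) ((1 ⊗ C) (Φ ⊗ ρ) (1 ⊗ C)ᴴ)`, where `Φ` is an EPR pair of `A₁ A'₁` and `C` acts
on `A'₁ A'₂`. -/
def goodChannel {d : ℕ} {B : Type*} [Fintype B] [DecidableEq B]
    (W : Matrix (Fin d) (Fin d) ℂ →ₗ[ℂ] Matrix B B ℂ)
    (C : Matrix (Fin d × Fin d) (Fin d × Fin d) ℂ) :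
    Matrix (Fin d) (Fin d) ℂ →ₗ[ℂ] Matrix (Fin d × B × B) (Fin d × B × B) ℂ where
  toFun ρ := tensorMap (LinearMap.id : Matrix (Fin d) (Fin d) ℂ →ₗ[ℂ] Matrix (Fin d) (Fin d) ℂ)
    (tensorMap W W)
    (((1 : Matrix (Fin d) (Fin d) ℂ) ⊗ₖ C) *
      Matrix.reindex (Equiv.prodAssoc _ _ _) (Equiv.prodAssoc _ _ _) (epr d ⊗ₖ ρ) *
      ((1 : Matrix (Fin d) (Fin d) ℂ) ⊗ₖ C).conjTranspose)
  map_add' ρ σ := by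
    rw [← map_add, Matrix.kronecker_add, ← add_mul, ← mul_add]
    rfl
  map_smul' c ρ := by
    rw [← map_smul, Matrix.kronecker_smul, ← smul_mul_assoc, ← mul_smul_comm]
    rfl

section Haar

variable {N : Type*} [Fintype N] [DecidableEq N]

instance : MeasurableSpace (Matrix.unitaryGroup N ℂ) := borel _

instance : BorelSpace (Matrix.unitaryGroup N ℂ) := ⟨rfl⟩

instance : CompactSpace (Matrix.unitaryGroup N ℂ) := by
  refine isCompact_iff_compactSpace.mp ?_
  have hK : IsCompact (Set.univ.pi fun _ : N => Set.univ.pi fun _ : N =>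
      Metric.closedBall (0 : ℂ) 1) :=
    isCompact_univ_pi fun _ => isCompact_univ_pi fun _ => isCompact_closedBall _ _
  refine hK.of_isClosed_subset (isClosed_unitary (R := Matrix N N ℂ)) ?_
  intro U hU i _ j _
  simpa using entry_norm_bound_of_unitary hU i j

/-- The Haar probability measure on the unitary group. -/
def haarUnitary (N : Type*) [Fintype N] [DecidableEq N] :
    MeasureTheory.Measure (Matrix.unitaryGroup N ℂ) :=
  MeasureTheory.Measure.haarMeasure ⊤

/-- `Uᴴ W(U ρ Uᴴ) U`. -/
def twirlTerm (W : Matrix N N ℂ →ₗ[ℂ] Matrix N N ℂ) (ρ : Matrix N N ℂ)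
    (U : Matrix.unitaryGroup N ℂ) : Matrix N N ℂ :=
  (U : Matrix N N ℂ).conjTranspose *
    W ((U : Matrix N N ℂ) * ρ * (U : Matrix N N ℂ).conjTranspose) * (U : Matrix N N ℂ)

/-- A finite set of unitaries is a unitary 2-design if twirling any channel with respect to it
is the same as twirling with respect to the Haar measure (the integral of a matrix-valued function
is taken entry by entry). -/
def IsUnitaryTwoDesign (𝒰 : Finset (Matrix.unitaryGroup N ℂ)) : Prop :=
  ∀ W : Matrix N N ℂ →ₗ[ℂ] Matrix N N ℂ, IsChannel W → ∀ ρ : Matrix N N ℂ, IsState ρ →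
    ((𝒰.card : ℂ)⁻¹ • ∑ U ∈ 𝒰, twirlTerm W ρ U) =
      Matrix.of fun i j => ∫ U, twirlTerm W ρ U i j ∂(haarUnitary N)

end Haar

end QuantumPolar

end

open QuantumPolar

/-!
Write `R(V) = tr (tr_A √ρ)²`, where `ρ` is the state that the channel `V` makes of an EPR pair: the
supremum over `σ` is a Hilbert-Schmidt norm by Cauchy-Schwarz (`rpow_petzRenyiHalf`). The state of
the good channel is `(Cᵀ ⊗ 1) (ρ ⊗ ρ) (Cᵀ ⊗ 1)ᴴ` up to the order of the systems
(`choiState_goodChannel`), so its square root is obtained from `√ρ` in the same way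
(`sqrt_goodLift`). Decomposing `√ρ ⊗ √ρ` into blocks `M` indexed by the output systems `B₁ B₂`, the
parameter of the good channel is a sum of terms `tr (tr₂ (Cᴴ M C) tr₂ (Cᴴ K C))`.

The average of such a term over a 2-design is `d / (d² + 1) (tr (M K) + tr M tr K)`
(`IsUnitaryTwoDesign.average_trace_traceSnd`). Here the terms with `tr (M K)` add up to
`(tr ρ)² = 1` and those with `tr M tr K` to `R(W)²`. The average rests on the computation of the
Haar twirl: it is unitarily covariant, hence a combination of `ρ ↦ (tr ρ) 1` and the identity
(`exists_eq_trace_smul_one_add_smul`), with coefficients determined by trace preservation and by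
the trace of the channel as a linear operator (`haarTwirl_eq`). The design property is used only
for channels that measure an effect and prepare a state.

Finally `1 / d ≤ R(W) ≤ d` (`trace_mul_self_le`, `trace_traceFst_mul_self_le`), and
`d / (d² + 1) (1 + R²) - R = (d R - 1) (R - d) / (d² + 1)`.
-/

open scoped MatrixOrder Kronecker ComplexOrder

namespace QuantumPolar

open Matrix MeasureTheory

/-! ### Twirling over the unitary group -/

section Twirl

variable {N : Type*} [Fintype N] [DecidableEq N]

/-- By the spectral theorem, the rank-one projections `U E_ii Uᴴ` span the Hermitian matrices over
the reals, hence all matrices over the complex numbers. -/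
theorem linearMap_eq_zero_of_conj_single {V : Type*} [AddCommGroup V] [Module ℂ V]
    (f : Matrix N N ℂ →ₗ[ℂ] V)
    (hf : ∀ (U : unitaryGroup N ℂ) (i : N),
      f ((U : Matrix N N ℂ) * single i i 1 * (U : Matrix N N ℂ)ᴴ) = 0) : f = 0 := by
  have herm : ∀ H : Matrix N N ℂ, H.IsHermitian → f H = 0 := by
    intro H hH
    have hdiag : diagonal (RCLike.ofReal ∘ hH.eigenvalues : N → ℂ) =
        ∑ i, ((hH.eigenvalues i : ℝ) : ℂ) • single i i (1 : ℂ) := by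
      ext a b
      simp [Matrix.sum_apply, single_apply, diagonal_apply, ite_and]
    rw [hH.spectral_theorem, Unitary.conjStarAlgAut_apply, hdiag, Finset.mul_sum, Finset.sum_mul,
      map_sum]
    refine Finset.sum_eq_zero fun i _ => ?_
    rw [mul_smul_comm, smul_mul_assoc, map_smul]
    have := hf hH.eigenvectorUnitary i
    rw [← star_eq_conjTranspose] at this
    rw [this, smul_zero]
  ext1 M
  have h := realPart_add_I_smul_imaginaryPart M
  rw [← h, map_add, map_smul, herm _ (realPart M).2, herm _ (imaginaryPart M).2]
  simp

instance : IsProbabilityMeasure (haarUnitary N) :=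
  ⟨by simpa [haarUnitary] using
    Measure.haarMeasure_self (K₀ := (⊤ : TopologicalSpace.PositiveCompacts (unitaryGroup N ℂ)))⟩

instance : (haarUnitary N).IsHaarMeasure := by unfold haarUnitary; infer_instance

instance : (haarUnitary N).IsMulRightInvariant := ⟨fun g => by
  have : IsProbabilityMeasure ((haarUnitary N).map (· * g)) :=
    Measure.isProbabilityMeasure_map (by fun_prop)
  exact Measure.isHaarMeasure_eq_of_isProbabilityMeasure _ _⟩

/-- Linear functionals commute with entrywise integration, so that the entrywise integral can be
used as an integral of matrices without choosing a norm on them. -/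
theorem map_integral_entries {μ : Measure (unitaryGroup N ℂ)} [IsFiniteMeasure μ]
    (φ : Matrix N N ℂ →ₗ[ℂ] ℂ) (f : unitaryGroup N ℂ → Matrix N N ℂ) (hf : Continuous f) :
    φ (of fun i j => ∫ U, f U i j ∂μ) = ∫ U, φ (f U) ∂μ := by
  have key : ∀ X : Matrix N N ℂ, φ X = ∑ i, ∑ j, X i j * φ (single i j 1) := by
    intro X
    conv_lhs => rw [matrix_eq_sum_single X]
    simp only [map_sum]
    refine Finset.sum_congr rfl fun i _ => Finset.sum_congr rfl fun j _ => ?_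
    rw [← smul_eq_mul (X i j), ← map_smul, smul_single, smul_eq_mul, mul_one]
  have hc : ∀ i j, Continuous fun U => f U i j := fun i j => hf.matrix_elem i j
  have hint : ∀ i j, Integrable (fun U => f U i j) μ := fun i j =>
    (hc i j).integrable_of_hasCompactSupport (HasCompactSupport.of_compactSpace _)
  rw [key]
  simp_rw [key (f _)]
  rw [integral_finsetSum _ fun i _ => integrable_finsetSum _ fun j _ => (hint i j).mul_const _]
  refine Finset.sum_congr rfl fun i _ => ?_
  rw [integral_finsetSum _ fun j _ => (hint i j).mul_const _]
  refine Finset.sum_congr rfl fun j _ => ?_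
  rw [integral_mul_const]
  rfl

theorem continuous_twirlTerm (T : Matrix N N ℂ →ₗ[ℂ] Matrix N N ℂ) (ρ : Matrix N N ℂ) :
    Continuous (twirlTerm T ρ) := by
  have hT : Continuous T := LinearMap.continuous_of_finiteDimensional T
  have h : Continuous fun U : unitaryGroup N ℂ => (U : Matrix N N ℂ) := continuous_subtype_val
  have h' := h.matrix_conjTranspose
  exact (h'.matrix_mul (hT.comp ((h.matrix_mul continuous_const).matrix_mul h'))).matrix_mul h

theorem integrable_twirlTerm_apply (T : Matrix N N ℂ →ₗ[ℂ] Matrix N N ℂ) (ρ : Matrix N N ℂ)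
    (i j : N) : Integrable (fun U => twirlTerm T ρ U i j) (haarUnitary N) :=
  ((continuous_twirlTerm T ρ).matrix_elem i j).integrable_of_hasCompactSupport
    (HasCompactSupport.of_compactSpace _)

/-- The map `ρ ↦ Uᴴ T(U ρ Uᴴ) U`, for fixed `U`, as a linear map. -/
def twirlMap (T : Matrix N N ℂ →ₗ[ℂ] Matrix N N ℂ) (U : unitaryGroup N ℂ) :
    Matrix N N ℂ →ₗ[ℂ] Matrix N N ℂ where
  toFun ρ := twirlTerm T ρ U
  map_add' ρ σ := by simp only [twirlTerm, mul_add, add_mul, map_add]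
  map_smul' c ρ := by simp [twirlTerm]

/-- The Haar twirl `ρ ↦ ∫ Uᴴ T(U ρ Uᴴ) U dU` of `T`; the integral is taken entry by entry. -/
noncomputable def haarTwirl (T : Matrix N N ℂ →ₗ[ℂ] Matrix N N ℂ) :
    Matrix N N ℂ →ₗ[ℂ] Matrix N N ℂ where
  toFun ρ := of fun i j => ∫ U, twirlTerm T ρ U i j ∂(haarUnitary N)
  map_add' ρ σ := by
    ext i j
    simp only [of_apply, Matrix.add_apply]
    rw [← integral_add (integrable_twirlTerm_apply _ _ _ _) (integrable_twirlTerm_apply _ _ _ _)]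
    congr 1
    ext U
    exact congrFun₂ (map_add (twirlMap T U) ρ σ) i j
  map_smul' c ρ := by
    ext i j
    simp only [of_apply, Matrix.smul_apply, RingHom.id_apply]
    rw [← integral_smul]
    congr 1
    ext U
    exact congrFun₂ (map_smul (twirlMap T U) c ρ) i j

theorem map_haarTwirl (T : Matrix N N ℂ →ₗ[ℂ] Matrix N N ℂ) (φ : Matrix N N ℂ →ₗ[ℂ] ℂ)
    (ρ : Matrix N N ℂ) :
    φ (haarTwirl T ρ) = ∫ U, φ (twirlTerm T ρ U) ∂(haarUnitary N) :=
  map_integral_entries φ _ (continuous_twirlTerm T ρ)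

theorem twirlTerm_conj (T : Matrix N N ℂ →ₗ[ℂ] Matrix N N ℂ) (U V : unitaryGroup N ℂ)
    (ρ : Matrix N N ℂ) :
    twirlTerm T ((V : Matrix N N ℂ) * ρ * (V : Matrix N N ℂ)ᴴ) U =
      (V : Matrix N N ℂ) * twirlTerm T ρ (U * V) * (V : Matrix N N ℂ)ᴴ := by
  have hV : (V : Matrix N N ℂ) * (V : Matrix N N ℂ)ᴴ = 1 := mem_unitaryGroup_iff.mp V.2
  simp only [twirlTerm, UnitaryGroup.mul_val, conjTranspose_mul, Matrix.mul_assoc, hV,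
    Matrix.mul_one]
  rw [← Matrix.mul_assoc (V : Matrix N N ℂ) (V : Matrix N N ℂ)ᴴ, hV, Matrix.one_mul]

/-- The Haar twirl is covariant under unitary conjugation, by right invariance of the Haar
measure. -/
theorem haarTwirl_conj (T : Matrix N N ℂ →ₗ[ℂ] Matrix N N ℂ) (V : unitaryGroup N ℂ)
    (ρ : Matrix N N ℂ) :
    haarTwirl T ((V : Matrix N N ℂ) * ρ * (V : Matrix N N ℂ)ᴴ) =
      (V : Matrix N N ℂ) * haarTwirl T ρ * (V : Matrix N N ℂ)ᴴ := by
  ext i j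
  let φ : Matrix N N ℂ →ₗ[ℂ] ℂ :=
    { toFun := fun X => ((V : Matrix N N ℂ) * X * (V : Matrix N N ℂ)ᴴ) i j
      map_add' := fun X Y => by simp only [mul_add, add_mul, Matrix.add_apply]
      map_smul' := fun c X => by simp }
  have h2 : ∀ U, twirlTerm T ((V : Matrix N N ℂ) * ρ * (V : Matrix N N ℂ)ᴴ) U i j =
      φ (twirlTerm T ρ (U * V)) := fun U => by rw [twirlTerm_conj]; rfl
  calc haarTwirl T ((V : Matrix N N ℂ) * ρ * (V : Matrix N N ℂ)ᴴ) i j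
      = ∫ U, twirlTerm T ((V : Matrix N N ℂ) * ρ * (V : Matrix N N ℂ)ᴴ) U i j
          ∂(haarUnitary N) := rfl
    _ = ∫ U, φ (twirlTerm T ρ (U * V)) ∂(haarUnitary N) := by simp_rw [h2]
    _ = ∫ U, φ (twirlTerm T ρ U) ∂(haarUnitary N) :=
        integral_mul_right_eq_self (fun U => φ (twirlTerm T ρ U)) V
    _ = φ (haarTwirl T ρ) := (map_haarTwirl T φ ρ).symm

theorem trace_twirlTerm (T : Matrix N N ℂ →ₗ[ℂ] Matrix N N ℂ) (hT : ∀ X, (T X).trace = X.trace)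
    (ρ : Matrix N N ℂ) (U : unitaryGroup N ℂ) : (twirlTerm T ρ U).trace = ρ.trace := by
  have hU : (U : Matrix N N ℂ)ᴴ * (U : Matrix N N ℂ) = 1 := mem_unitaryGroup_iff'.mp U.2
  have hU' : (U : Matrix N N ℂ) * (U : Matrix N N ℂ)ᴴ = 1 := mem_unitaryGroup_iff.mp U.2
  rw [twirlTerm, trace_mul_comm, ← Matrix.mul_assoc, hU', Matrix.one_mul, hT, trace_mul_comm,
    ← Matrix.mul_assoc, hU, Matrix.one_mul]

theorem trace_haarTwirl (T : Matrix N N ℂ →ₗ[ℂ] Matrix N N ℂ) (hT : ∀ X, (T X).trace = X.trace)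
    (ρ : Matrix N N ℂ) : (haarTwirl T ρ).trace = ρ.trace := by
  have := map_haarTwirl T (traceLinearMap N ℂ ℂ) ρ
  simpa [trace_twirlTerm T hT] using this

/-- The trace of a linear map on matrices, in the basis of matrix units. -/
theorem linearMap_trace_eq_sum (L : Matrix N N ℂ →ₗ[ℂ] Matrix N N ℂ) :
    LinearMap.trace ℂ _ L = ∑ i, ∑ j, L (single i j 1) i j := by
  rw [LinearMap.trace_eq_matrix_trace ℂ (Matrix.stdBasis ℂ N N), Matrix.trace,
    Fintype.sum_prod_type]
  refine Finset.sum_congr rfl fun i _ => Finset.sum_congr rfl fun j _ => ?_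
  rw [Matrix.diag_apply, LinearMap.toMatrix_apply, Matrix.stdBasis_eq_single]
  simp [Matrix.stdBasis]

/-- Twirling preserves the trace of a map: `twirlMap T U` is `T` conjugated by the invertible map
`X ↦ Uᴴ X U`. -/
theorem linearMap_trace_haarTwirl (T : Matrix N N ℂ →ₗ[ℂ] Matrix N N ℂ) :
    LinearMap.trace ℂ _ (haarTwirl T) = LinearMap.trace ℂ _ T := by
  have h1 : ∀ U : unitaryGroup N ℂ, ∑ i, ∑ j, twirlTerm T (single i j 1) U i j =
      LinearMap.trace ℂ _ T := by
    intro U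
    have hU : (U : Matrix N N ℂ)ᴴ * (U : Matrix N N ℂ) = 1 := mem_unitaryGroup_iff'.mp U.2
    have hU' : (U : Matrix N N ℂ) * (U : Matrix N N ℂ)ᴴ = 1 := mem_unitaryGroup_iff.mp U.2
    let e : Matrix N N ℂ ≃ₗ[ℂ] Matrix N N ℂ :=
      { toFun := fun X => (U : Matrix N N ℂ)ᴴ * X * (U : Matrix N N ℂ)
        map_add' := fun X Y => by simp only [mul_add, add_mul]
        map_smul' := fun c X => by simp
        invFun := fun X => (U : Matrix N N ℂ) * X * (U : Matrix N N ℂ)ᴴ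
        left_inv := fun X => by
          simp only [← Matrix.mul_assoc, hU', Matrix.one_mul]
          simp only [Matrix.mul_assoc, hU', Matrix.mul_one]
        right_inv := fun X => by
          simp only [← Matrix.mul_assoc, hU, Matrix.one_mul]
          simp only [Matrix.mul_assoc, hU, Matrix.mul_one] }
    have he : twirlMap T U = e.conj T := rfl
    rw [← LinearMap.trace_conj' T e, ← he, linearMap_trace_eq_sum]
    rfl
  rw [linearMap_trace_eq_sum]
  change ∑ i, ∑ j, ∫ U, twirlTerm T (single i j 1) U i j ∂(haarUnitary N) = _
  simp_rw [← integral_finsetSum _ fun j _ =>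
    integrable_twirlTerm_apply T (single _ j 1) _ j]
  rw [← integral_finsetSum _ fun i _ => integrable_finsetSum _ fun j _ =>
    integrable_twirlTerm_apply T (single i j 1) i j]
  simp [h1]

/-- A matrix fixed under conjugation by diagonal unitaries has no off-diagonal entries. -/
theorem eq_zero_of_conj_phase {X : Matrix N N ℂ} {i j : N} (hij : i ≠ j)
    (hX : ∀ V : unitaryGroup N ℂ, (∃ v : N → ℂ, (V : Matrix N N ℂ) = diagonal v) →
      (V : Matrix N N ℂ) * X * (V : Matrix N N ℂ)ᴴ = X) : X i j = 0 := by
  -- A sign at `i` changes the sign of the entry at `(i, j)`.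
  let v : N → ℂ := fun k => if k = i then -1 else 1
  have hv : diagonal v ∈ unitaryGroup N ℂ := by
    rw [mem_unitaryGroup_iff, star_eq_conjTranspose, diagonal_conjTranspose, diagonal_mul_diagonal,
      ← diagonal_one]
    congr 1
    ext k
    by_cases hk : k = i <;> simp [v, hk]
  have h := congrFun₂ (hX ⟨diagonal v, hv⟩ ⟨v, rfl⟩) i j
  simp only [diagonal_conjTranspose, mul_diagonal, diagonal_mul] at h
  simp [v, hij.symm] at h
  linear_combination (-1 / 2) * h

/-- A unitarily covariant map is a combination of `ρ ↦ tr ρ` and the identity. Covariance under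
diagonal unitaries and permutations gives this at the matrix units `E_kk`; covariance under all
unitaries then carries it to all rank-one projections. -/
theorem exists_eq_trace_smul_one_add_smul (L : Matrix N N ℂ →ₗ[ℂ] Matrix N N ℂ)
    (hL : ∀ (V : unitaryGroup N ℂ) (ρ : Matrix N N ℂ),
      L ((V : Matrix N N ℂ) * ρ * (V : Matrix N N ℂ)ᴴ) =
        (V : Matrix N N ℂ) * L ρ * (V : Matrix N N ℂ)ᴴ) [Nontrivial N] :
    ∃ a b : ℂ, ∀ ρ, L ρ = (a * ρ.trace) • (1 : Matrix N N ℂ) + b • ρ := by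
  have hoff : ∀ i j k : N, i ≠ j → L (single k k 1) i j = 0 := by
    intro i j k hij
    refine eq_zero_of_conj_phase hij fun V ⟨v, hv⟩ => ?_
    rw [← hL]
    congr 1
    have h1 : (V : Matrix N N ℂ) * (V : Matrix N N ℂ)ᴴ = 1 := mem_unitaryGroup_iff.mp V.2
    rw [hv, diagonal_conjTranspose, diagonal_mul_diagonal, ← diagonal_one, diagonal_eq_diagonal_iff]
      at h1
    rw [hv, diagonal_conjTranspose]
    ext a b
    simp only [mul_diagonal, diagonal_mul, single_apply]
    split_ifs with h
    · obtain ⟨rfl, rfl⟩ := h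
      simpa using h1 k
    · simp
  have hperm : ∀ (π : Equiv.Perm N) (i k : N),
      L (single (π k) (π k) 1) (π i) (π i) = L (single k k 1) i i := by
    intro π i k
    let P : Matrix N N ℂ := of fun a b => if a = π b then 1 else 0
    have hP : P ∈ unitaryGroup N ℂ := by
      rw [mem_unitaryGroup_iff']
      ext a b
      simp [P, mul_apply, star_eq_conjTranspose, one_apply, eq_comm]
    have h := congrFun₂ (hL ⟨P, hP⟩ (single k k 1)) (π i) (π i)
    have e1 : ∀ X : Matrix N N ℂ, ∀ a b, (P * X * Pᴴ) a b = X (π.symm a) (π.symm b) := by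
      intro X a b
      simp [P, mul_apply, ← Equiv.symm_apply_eq]
    have e2 : P * single k k 1 * Pᴴ = single (π k) (π k) 1 := by
      ext a b
      rw [e1, single_apply, single_apply]
      simp [Equiv.eq_symm_apply]
    rw [e1, e2] at h
    simpa using h
  obtain ⟨i₀, k₀, h₀⟩ := exists_pair_ne N
  -- The diagonal of `L E_kk` has the entry `c` at `k` and `a` elsewhere, the same for every `k`.
  set a := L (single k₀ k₀ 1) i₀ i₀ with ha
  set c := L (single k₀ k₀ 1) k₀ k₀ with hc
  have hdiag : ∀ k, L (single k k 1) k k = c := fun k => by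
    simpa using hperm (Equiv.swap k₀ k) k₀ k₀
  have hne0 : ∀ i, i ≠ k₀ → L (single k₀ k₀ 1) i i = a := fun i hi => by
    have := hperm (Equiv.swap i₀ i) i₀ k₀
    rwa [Equiv.swap_apply_of_ne_of_ne h₀.symm hi.symm, Equiv.swap_apply_left] at this
  have hne : ∀ i k, i ≠ k → L (single k k 1) i i = a := fun i k hik => by
    have := hperm (Equiv.swap k k₀) i k
    rw [Equiv.swap_apply_left] at this
    rw [← this]
    apply hne0
    intro h
    apply hik
    rw [Equiv.swap_apply_eq_iff] at h
    simpa using h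
  let L₀ : Matrix N N ℂ →ₗ[ℂ] Matrix N N ℂ :=
    L - ((a • (traceLinearMap N ℂ ℂ)).smulRight (1 : Matrix N N ℂ) + (c - a) • LinearMap.id)
  have hL₀ : L₀ = 0 := by
    apply linearMap_eq_zero_of_conj_single
    intro U i
    have hU : (U : Matrix N N ℂ)ᴴ * (U : Matrix N N ℂ) = 1 := mem_unitaryGroup_iff'.mp U.2
    have hU' : (U : Matrix N N ℂ) * (U : Matrix N N ℂ)ᴴ = 1 := mem_unitaryGroup_iff.mp U.2
    have hs : L (single i i 1) = a • (1 : Matrix N N ℂ) + (c - a) • single i i 1 := by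
      ext p q
      by_cases hpq : p = q
      · subst hpq
        by_cases hp : p = i
        · subst hp; simp [hdiag]
        · rw [hne p i hp]; simp [Ne.symm hp]
      · rw [hoff p q i hpq]
        have : ¬ (i = p ∧ i = q) := fun h => hpq (h.1.symm.trans h.2)
        simp [one_apply, hpq, this]
    have htr : ((U : Matrix N N ℂ) * single i i (1 : ℂ) * (U : Matrix N N ℂ)ᴴ).trace = 1 := by
      rw [trace_mul_comm, ← Matrix.mul_assoc, hU, Matrix.one_mul, trace_single_eq_same]
    simp only [L₀, LinearMap.sub_apply, LinearMap.add_apply, LinearMap.smulRight_apply,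
      LinearMap.smul_apply, LinearMap.id_apply, traceLinearMap_apply]
    rw [hL, hs, htr, mul_add, add_mul, mul_smul_comm, smul_mul_assoc, mul_smul_comm,
      smul_mul_assoc, mul_one, hU', smul_eq_mul, mul_one, sub_self]
  refine ⟨a, c - a, fun ρ => ?_⟩
  have := congrArg (fun f => f ρ) hL₀
  simp only [L₀, LinearMap.sub_apply, LinearMap.add_apply, LinearMap.smulRight_apply,
      LinearMap.smul_apply, LinearMap.id_apply, traceLinearMap_apply, LinearMap.zero_apply,
      smul_eq_mul] at this
  exact sub_eq_zero.mp this

/-! ### Averages over unitary 2-designs -/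

/-- The Haar twirl of a trace-preserving map `T` is the depolarizing map with the same trace as `T`,
considered as a linear operator on matrices; with `D` the dimension, `b = (Tr T - 1) / (D² - 1)`. -/
theorem haarTwirl_eq [Nontrivial N] (T : Matrix N N ℂ →ₗ[ℂ] Matrix N N ℂ)
    (hT : ∀ X, (T X).trace = X.trace) (ρ : Matrix N N ℂ) {b : ℂ}
    (hb : LinearMap.trace ℂ _ T = 1 + b * ((Fintype.card N : ℂ) ^ 2 - 1)) :
    haarTwirl T ρ = ((1 - b) / Fintype.card N * ρ.trace) • (1 : Matrix N N ℂ) + b • ρ := by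
  obtain ⟨a, b', h⟩ := exists_eq_trace_smul_one_add_smul _ (haarTwirl_conj T)
  have hD : (1 : ℝ) < Fintype.card N := by exact_mod_cast Fintype.one_lt_card
  have hD0 : (Fintype.card N : ℂ) ≠ 0 := by exact_mod_cast (by linarith : (Fintype.card N : ℝ) ≠ 0)
  have hD1 : (Fintype.card N : ℂ) ^ 2 - 1 ≠ 0 := by
    have : (Fintype.card N : ℝ) ^ 2 - 1 ≠ 0 := by nlinarith
    exact_mod_cast this
  have h1 : a * Fintype.card N + b' = 1 := by
    obtain ⟨i⟩ : Nonempty N := inferInstance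
    have := trace_haarTwirl T hT (single i i 1)
    simpa [h] using this
  have h2 : a * Fintype.card N + b' * (Fintype.card N : ℂ) ^ 2 = LinearMap.trace ℂ _ T := by
    rw [← linearMap_trace_haarTwirl, linearMap_trace_eq_sum]
    have e : ∀ i j : N, haarTwirl T (single i j 1) i j = (if i = j then a else 0) + b' := by
      intro i j
      rw [h]
      by_cases hij : i = j
      · subst hij; simp
      · simp [hij]
    simp only [e, Finset.sum_add_distrib]
    simp
    ring
  have hbb : b' = b := by
    have : (b' - b) * ((Fintype.card N : ℂ) ^ 2 - 1) = 0 := by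
      linear_combination h2 - h1 + hb
    exact sub_eq_zero.mp ((mul_eq_zero.mp this).resolve_right hD1)
  subst hbb
  rw [h]
  congr 3
  field_simp
  linear_combination h1

/-- The map `X ↦ tr (M X) σ`: measure the effect `M`, then prepare `σ`. -/
def measurePrepare (M σ : Matrix N N ℂ) : Matrix N N ℂ →ₗ[ℂ] Matrix N N ℂ :=
  ((traceLinearMap N ℂ ℂ).comp (LinearMap.mulLeft ℂ M)).smulRight σ

@[simp] theorem measurePrepare_apply (M σ X : Matrix N N ℂ) :
    measurePrepare M σ X = (M * X).trace • σ := rfl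

theorem linearMap_trace_measurePrepare (M σ : Matrix N N ℂ) :
    LinearMap.trace ℂ _ (measurePrepare M σ) = (M * σ).trace := by
  rw [linearMap_trace_eq_sum, Matrix.trace, Finset.sum_comm]
  refine Finset.sum_congr rfl fun i _ => ?_
  rw [diag_apply, mul_apply]
  refine Finset.sum_congr rfl fun j _ => ?_
  rw [measurePrepare_apply, Matrix.smul_apply, trace_mul_comm, trace_single_mul, smul_eq_mul,
    one_smul]

/-- `measurePrepare M σ` is completely positive: with `M = Lᴴ L`, the first tensor factor of the
image of `Z` is `∑ c, V c Z (V c)ᴴ`, where `V c = 1 ⊗ ⟨c|L`. -/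
theorem posSemidef_tensorMap_id_measurePrepare {k : ℕ} {M σ : Matrix N N ℂ} (hM : M.PosSemidef)
    (hσ : σ.PosSemidef) {Z : Matrix (Fin k × N) (Fin k × N) ℂ} (hZ : Z.PosSemidef) :
    (tensorMap (LinearMap.id : Matrix (Fin k) (Fin k) ℂ →ₗ[ℂ] Matrix (Fin k) (Fin k) ℂ)
      (measurePrepare M σ) Z).PosSemidef := by
  obtain ⟨L, rfl⟩ := CStarAlgebra.nonneg_iff_eq_star_mul_self.mp hM.nonneg
  rw [star_eq_conjTranspose]
  let V : N → Matrix (Fin k) (Fin k × N) ℂ := fun c => of fun i p => if i = p.1 then L c p.2 else 0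
  have h : tensorMap (LinearMap.id : Matrix (Fin k) (Fin k) ℂ →ₗ[ℂ] Matrix (Fin k) (Fin k) ℂ)
      (measurePrepare (Lᴴ * L) σ) Z = (∑ c, V c * Z * (V c)ᴴ) ⊗ₖ σ := by
    ext ⟨i, x⟩ ⟨j, y⟩
    have e1 : ∀ a b, ((Lᴴ * L) * single a b (1 : ℂ)).trace = ∑ c, star (L c b) * L c a := by
      intro a b
      rw [trace_mul_comm, trace_single_mul, one_smul, mul_apply]
      rfl
    have e2 : ∀ c, (V c * Z * (V c)ᴴ) i j =
        ∑ a, ∑ b, L c a * Z (i, a) (j, b) * star (L c b) := by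
      intro c
      have e3 : ∀ q, (V c * Z) i q = ∑ a, L c a * Z (i, a) q := fun q => by
        rw [mul_apply, Fintype.sum_prod_type, Fintype.sum_eq_single i]
        · simp [V]
        · intro i' hi'
          simp [V, hi'.symm]
      rw [mul_apply, Fintype.sum_prod_type, Fintype.sum_eq_single j, Finset.sum_comm]
      · simp [V, e3, Finset.sum_mul]
      · intro j' hj'
        simp [V, hj'.symm]
    rw [kroneckerMap_apply, Matrix.sum_apply]
    simp only [e2, tensorMap, LinearMap.coe_mk, AddHom.coe_mk, LinearMap.id_apply,
      measurePrepare_apply, Matrix.sum_apply, Matrix.smul_apply, kroneckerMap_apply, smul_eq_mul,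
      single_apply, e1, Fintype.sum_prod_type]
    rw [Fintype.sum_eq_single i fun i' hi' => by simp [hi']]
    have e4 : ∀ a, ∑ j', ∑ b, Z (i, a) (j', b) * ((if i = i ∧ j' = j then 1 else 0) *
        ((∑ c, star (L c b) * L c a) * σ x y)) =
        ∑ b, ∑ c, L c a * Z (i, a) (j, b) * star (L c b) * σ x y := by
      intro a
      rw [Fintype.sum_eq_single j fun j' hj' => by simp [hj']]
      refine Finset.sum_congr rfl fun b _ => ?_
      simp only [and_self, if_true, one_mul, Finset.sum_mul, Finset.mul_sum]
      exact Finset.sum_congr rfl fun c _ => by ring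
    refine (Finset.sum_congr rfl fun a _ => e4 a).trans ?_
    simp only [Finset.sum_mul]
    symm
    rw [Finset.sum_comm]
    refine Finset.sum_congr rfl fun a _ => ?_
    rw [Finset.sum_comm]
  rw [h]
  exact (posSemidef_sum _ fun c _ => hZ.mul_mul_conjTranspose_same _).kronecker hσ

theorem isChannel_measurePrepare_add {M σ τ : Matrix N N ℂ} (hM : M.PosSemidef)
    (hM' : (1 - M).PosSemidef) (hσ : IsState σ) (hτ : IsState τ) :
    IsChannel (measurePrepare M σ + measurePrepare (1 - M) τ) := by
  refine ⟨fun k Z hZ => ?_, fun ρ => ?_⟩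
  · have h : tensorMap (LinearMap.id : Matrix (Fin k) (Fin k) ℂ →ₗ[ℂ] Matrix (Fin k) (Fin k) ℂ)
        (measurePrepare M σ + measurePrepare (1 - M) τ) Z =
        tensorMap LinearMap.id (measurePrepare M σ) Z +
          tensorMap LinearMap.id (measurePrepare (1 - M) τ) Z := by
      simp only [tensorMap, LinearMap.coe_mk, AddHom.coe_mk, LinearMap.add_apply, kronecker_add,
        smul_add, Finset.sum_add_distrib]
    rw [h]
    exact (posSemidef_tensorMap_id_measurePrepare hM hσ.1 hZ).add
      (posSemidef_tensorMap_id_measurePrepare hM' hτ.1 hZ)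
  · simp [hσ.2, hτ.2, sub_mul]

/-- A rank-one projection: a Hermitian idempotent of trace one. -/
structure IsPure (P : Matrix N N ℂ) : Prop where
  isHermitian : P.IsHermitian
  mul_self : P * P = P
  trace_eq : P.trace = 1

theorem IsPure.posSemidef {ι : Type*} [Fintype ι] {P : Matrix ι ι ℂ} (hP : IsPure P) :
    P.PosSemidef := by
  have := posSemidef_conjTranspose_mul_self P
  rwa [hP.isHermitian.eq, hP.mul_self] at this

theorem IsPure.posSemidef_one_sub {P : Matrix N N ℂ} (hP : IsPure P) : (1 - P).PosSemidef := by
  have := posSemidef_conjTranspose_mul_self (1 - P)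
  rwa [conjTranspose_sub, conjTranspose_one, hP.isHermitian.eq,
    show (1 - P) * (1 - P) = 1 - P by
      rw [mul_sub, mul_one, sub_mul, one_mul, hP.mul_self, sub_self, sub_zero]] at this

theorem IsPure.isState {ι : Type*} [Fintype ι] {P : Matrix ι ι ℂ} (hP : IsPure P) : IsState P :=
  ⟨hP.posSemidef, hP.trace_eq⟩

theorem isState_smul_one [Nonempty N] :
    IsState ((Fintype.card N : ℂ)⁻¹ • (1 : Matrix N N ℂ)) := by
  refine ⟨PosSemidef.one.smul (by positivity), ?_⟩
  rw [trace_smul, trace_one, smul_eq_mul, inv_mul_cancel₀]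
  simp

/-- Rank-one projections span all matrices. -/
theorem isPure_induction {p : Matrix N N ℂ → Prop} (hadd : ∀ X Y, p X → p Y → p (X + Y))
    (hsmul : ∀ (c : ℂ) X, p X → p (c • X)) (hpure : ∀ P, IsPure P → p P) (hzero : p 0)
    (X : Matrix N N ℂ) : p X := by
  let S : Submodule ℂ (Matrix N N ℂ) :=
    { carrier := {X | p X}
      add_mem' := fun {X Y} hX hY => hadd X Y hX hY
      zero_mem' := hzero
      smul_mem' := fun c X hX => hsmul c X hX }
  have h0 : S.mkQ = 0 := by
    refine linearMap_eq_zero_of_conj_single _ fun U i => ?_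
    have hU : (U : Matrix N N ℂ)ᴴ * (U : Matrix N N ℂ) = 1 := mem_unitaryGroup_iff'.mp U.2
    refine (Submodule.Quotient.mk_eq_zero S).mpr (hpure _ ⟨?_, ?_, ?_⟩)
    · exact isHermitian_mul_mul_conjTranspose _ (by simp [IsHermitian])
    · calc (U : Matrix N N ℂ) * single i i 1 * (U : Matrix N N ℂ)ᴴ *
          ((U : Matrix N N ℂ) * single i i 1 * (U : Matrix N N ℂ)ᴴ)
          = (U : Matrix N N ℂ) * (single i i 1 * ((U : Matrix N N ℂ)ᴴ * (U : Matrix N N ℂ)) *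
            single i i 1) * (U : Matrix N N ℂ)ᴴ := by simp only [Matrix.mul_assoc]
        _ = _ := by rw [hU]; simp
    · rw [trace_mul_comm, ← Matrix.mul_assoc, hU, Matrix.one_mul, trace_single_eq_same]
  exact (Submodule.Quotient.mk_eq_zero S).mp (congrArg (fun f => f X) h0)

variable [Nontrivial N] {𝒰 : Finset (unitaryGroup N ℂ)}

/-- The empty set is not a 2-design: its averages vanish, whereas the Haar twirl of a channel
preserves the trace. -/
theorem IsUnitaryTwoDesign.card_ne_zero (h𝒰 : IsUnitaryTwoDesign 𝒰) : (𝒰.card : ℂ) ≠ 0 := by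
  intro h0
  have hσ := isState_smul_one (N := N)
  have hT := isChannel_measurePrepare_add PosSemidef.one (by simpa using PosSemidef.zero) hσ hσ
  have h := h𝒰 _ hT _ hσ
  rw [h0, _root_.inv_zero, zero_smul] at h
  have h2 := trace_haarTwirl _ hT.2 ((Fintype.card N : ℂ)⁻¹ • (1 : Matrix N N ℂ))
  change (of _).trace = _ at h2
  rw [← h, trace_zero, hσ.2] at h2
  exact zero_ne_one h2

/-- The 2-design property, applied to the channel `X ↦ tr (M X) K + tr ((1 - M) X) 1 / D`. Removing
its constant part `1 / D` leaves the average of the traceless part of `Uᴴ K U`, weighted by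
`tr (M U ρ Uᴴ)`. -/
theorem IsUnitaryTwoDesign.average_of_isPure (h𝒰 : IsUnitaryTwoDesign 𝒰) {M K ρ : Matrix N N ℂ}
    (hM : IsPure M) (hK : IsPure K) (hρ : IsPure ρ) :
    (𝒰.card : ℂ)⁻¹ • ∑ U ∈ 𝒰, (M * ((U : Matrix N N ℂ) * ρ * (U : Matrix N N ℂ)ᴴ)).trace •
        ((U : Matrix N N ℂ)ᴴ * K * (U : Matrix N N ℂ) - (K.trace / Fintype.card N) • 1) =
      (((M * K).trace - M.trace * K.trace / Fintype.card N) / ((Fintype.card N : ℂ) ^ 2 - 1)) •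
        (ρ - (ρ.trace / Fintype.card N) • 1) := by
  have hD : (1 : ℝ) < Fintype.card N := by exact_mod_cast Fintype.one_lt_card
  have hD0 : (Fintype.card N : ℂ) ≠ 0 := by exact_mod_cast (by linarith : (Fintype.card N : ℝ) ≠ 0)
  have hD1 : (Fintype.card N : ℂ) ^ 2 - 1 ≠ 0 := by
    have : (Fintype.card N : ℝ) ^ 2 - 1 ≠ 0 := by nlinarith
    exact_mod_cast this
  set D : ℂ := (Fintype.card N : ℂ) with hDdef
  set τ : Matrix N N ℂ := D⁻¹ • 1 with hτ
  have hT := isChannel_measurePrepare_add hM.posSemidef hM.posSemidef_one_sub hK.isState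
    (isState_smul_one (N := N))
  have htr : LinearMap.trace ℂ _ (measurePrepare M K + measurePrepare (1 - M) τ) =
      1 + ((M * K).trace - D⁻¹) / (D ^ 2 - 1) * (D ^ 2 - 1) := by
    rw [map_add, linearMap_trace_measurePrepare, linearMap_trace_measurePrepare,
      div_mul_cancel₀ _ hD1]
    simp [hτ, hM.trace_eq, ← hDdef, mul_sub, inv_mul_cancel₀ hD0]
    ring
  have h := h𝒰 _ hT ρ hρ.isState
  have h2 := haarTwirl_eq _ hT.2 ρ htr
  change of _ = _ at h2
  rw [h2] at h
  have hterm : ∀ U : unitaryGroup N ℂ,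
      (M * ((U : Matrix N N ℂ) * ρ * (U : Matrix N N ℂ)ᴴ)).trace •
        ((U : Matrix N N ℂ)ᴴ * K * (U : Matrix N N ℂ) - (K.trace / D) • 1) =
      twirlTerm (measurePrepare M K + measurePrepare (1 - M) τ) ρ U - τ := by
    intro U
    have hU : (U : Matrix N N ℂ)ᴴ * (U : Matrix N N ℂ) = 1 := mem_unitaryGroup_iff'.mp U.2
    have ht : ((U : Matrix N N ℂ) * ρ * (U : Matrix N N ℂ)ᴴ).trace = 1 := by
      rw [trace_mul_comm, ← Matrix.mul_assoc, hU, Matrix.one_mul, hρ.trace_eq]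
    simp only [twirlTerm, LinearMap.add_apply, measurePrepare_apply, sub_mul, one_mul, trace_sub,
      ht, hτ, mul_add, add_mul, Matrix.mul_smul, Matrix.smul_mul, mul_one, hU, hK.trace_eq]
    module
  simp_rw [hterm]
  rw [Finset.sum_sub_distrib, smul_sub, h, Finset.sum_const, ← Nat.cast_smul_eq_nsmul ℂ, smul_smul,
    inv_mul_cancel₀ h𝒰.card_ne_zero, hM.trace_eq, hK.trace_eq, hρ.trace_eq, hτ]
  match_scalars
  · field_simp
    ring
  · field_simp

/-- The identity `IsUnitaryTwoDesign.average_of_isPure` is linear in each of `M`, `K` and `ρ`, so it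
extends from rank-one projections to all matrices. -/
theorem IsUnitaryTwoDesign.average (h𝒰 : IsUnitaryTwoDesign 𝒰) (M K ρ : Matrix N N ℂ) (u v : N) :
    (𝒰.card : ℂ)⁻¹ * ∑ U ∈ 𝒰, (M * ((U : Matrix N N ℂ) * ρ * (U : Matrix N N ℂ)ᴴ)).trace *
        ((U : Matrix N N ℂ)ᴴ * K * (U : Matrix N N ℂ) - (K.trace / Fintype.card N) • 1) u v =
      (((M * K).trace - M.trace * K.trace / Fintype.card N) / ((Fintype.card N : ℂ) ^ 2 - 1)) *
        (ρ - (ρ.trace / Fintype.card N) • 1) u v := by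
  induction M using isPure_induction with
  | hzero => simp
  | hadd X Y hX hY =>
    simp only [add_mul, trace_add, Finset.sum_add_distrib, mul_add] at hX hY ⊢
    rw [hX, hY]
    ring
  | hsmul c X hX =>
    simp only [Matrix.smul_mul, trace_smul, smul_eq_mul, mul_assoc, ← Finset.mul_sum] at hX ⊢
    rw [mul_left_comm, hX]
    ring
  | hpure M hM =>
  induction K using isPure_induction with
  | hzero => simp
  | hadd X Y hX hY =>
    simp only [add_mul, trace_add, Finset.sum_add_distrib, mul_add, Matrix.sub_apply,
      Matrix.add_apply, add_div, add_smul, mul_sub, Finset.sum_sub_distrib] at hX hY ⊢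
    linear_combination hX + hY
  | hsmul c X hX =>
    simp only [Matrix.smul_mul, Matrix.mul_smul, trace_smul, smul_eq_mul, Matrix.sub_apply,
      Matrix.smul_apply] at hX ⊢
    simp only [mul_div_assoc, mul_assoc c, ← mul_sub, mul_left_comm _ c, ← Finset.mul_sum] at hX ⊢
    linear_combination c * hX
  | hpure K hK =>
  induction ρ using isPure_induction with
  | hzero => simp
  | hadd X Y hX hY =>
    simp only [add_mul, trace_add, Finset.sum_add_distrib, mul_add] at hX hY ⊢
    rw [hX, hY]
    simp only [Matrix.sub_apply, Matrix.add_apply, Matrix.smul_apply, smul_eq_mul]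
    ring
  | hsmul c X hX =>
    simp only [Matrix.smul_mul, Matrix.mul_smul, trace_smul, smul_eq_mul, mul_assoc,
      ← Finset.mul_sum] at hX ⊢
    rw [mul_left_comm, hX]
    simp only [Matrix.sub_apply, Matrix.smul_apply, smul_eq_mul]
    ring
  | hpure ρ hρ =>
  have := congrFun₂ (h𝒰.average_of_isPure hM hK hρ) u v
  simpa only [Matrix.smul_apply, Matrix.sum_apply, smul_eq_mul] using this

/-- The partial trace over the second factor. -/
def traceSnd {A B : Type*} [Fintype B] (X : Matrix (A × B) (A × B) ℂ) : Matrix A A ℂ :=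
  of fun i j => ∑ k, X (i, k) (j, k)

theorem trace_traceSnd_mul_traceSnd {A B : Type*} [Fintype A] [Fintype B]
    (X Y : Matrix (A × B) (A × B) ℂ) :
    (traceSnd X * traceSnd Y).trace =
      ∑ x : A × B, ∑ y : A × B, X (x.1, x.2) (y.1, x.2) * Y (y.1, y.2) (x.1, y.2) := by
  simp only [Matrix.trace, diag_apply, mul_apply, traceSnd, of_apply, Fintype.sum_prod_type,
    Finset.sum_mul_sum]
  exact Finset.sum_congr rfl fun i _ => Finset.sum_comm

/-- The second moment formula for partial traces. An entry of the first factor is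
`(Uᴴ M U) x y = tr (M U E_yx Uᴴ)`, so the design property applies with `ρ` running over matrix
units and `M`, `K` entering through the channel. The trace part of `K` contributes the constant
`tr M tr K / d`, because partial traces preserve the trace; no first moment is needed. -/
theorem IsUnitaryTwoDesign.average_trace_traceSnd {d : ℕ} (hd : 2 ≤ d)
    {𝒰 : Finset (unitaryGroup (Fin d × Fin d) ℂ)} (h𝒰 : IsUnitaryTwoDesign 𝒰)
    (M K : Matrix (Fin d × Fin d) (Fin d × Fin d) ℂ) :
    (𝒰.card : ℂ)⁻¹ * ∑ U ∈ 𝒰, (traceSnd (U.1ᴴ * M * U.1) * traceSnd (U.1ᴴ * K * U.1)).trace =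
      (d : ℂ) / ((d : ℂ) ^ 2 + 1) * ((M * K).trace + M.trace * K.trace) := by
  have : Nontrivial (Fin d) := Fin.nontrivial_iff_two_le.mpr hd
  have hd1 : (2 : ℝ) ≤ d := by exact_mod_cast hd
  have hd0 : (d : ℂ) ≠ 0 := by exact_mod_cast (by linarith : (d : ℝ) ≠ 0)
  have hdp : (d : ℂ) ^ 2 + 1 ≠ 0 := by
    exact_mod_cast (by positivity : (d : ℝ) ^ 2 + 1 ≠ 0)
  have hdm : (d : ℂ) ^ 2 - 1 ≠ 0 := by
    have : (d : ℝ) ^ 2 - 1 ≠ 0 := by nlinarith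
    exact_mod_cast this
  have hdm4 : ((d : ℂ) * d) ^ 2 - 1 ≠ 0 := by
    rw [show ((d : ℂ) * d) ^ 2 - 1 = ((d : ℂ) ^ 2 - 1) * ((d : ℂ) ^ 2 + 1) by ring]
    exact mul_ne_zero hdm hdp
  have hcard : (Fintype.card (Fin d × Fin d) : ℂ) = d * d := by simp
  let ρ : Fin d × Fin d → Fin d × Fin d → Matrix (Fin d × Fin d) (Fin d × Fin d) ℂ :=
    fun x y => single (y.1, x.2) (x.1, x.2) 1
  have hU : ∀ U : unitaryGroup (Fin d × Fin d) ℂ,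
      (traceSnd (U.1ᴴ * M * U.1) * traceSnd (U.1ᴴ * K * U.1)).trace =
      (∑ x : Fin d × Fin d, ∑ y : Fin d × Fin d, (M * (U.1 * ρ x y * U.1ᴴ)).trace *
        (U.1ᴴ * K * U.1 - (K.trace / Fintype.card (Fin d × Fin d)) • 1) y (x.1, y.2)) +
      M.trace * K.trace / d := by
    intro U
    have hU' : U.1 * U.1ᴴ = 1 := mem_unitaryGroup_iff.mp U.2
    have e1 : ∀ x y, (M * (U.1 * ρ x y * U.1ᴴ)).trace = (U.1ᴴ * M * U.1) x (y.1, x.2) := by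
      intro x y
      rw [← Matrix.mul_assoc, trace_mul_comm, ← Matrix.mul_assoc, ← Matrix.mul_assoc,
        trace_mul_comm, trace_single_mul, one_smul]
    have e2 : ∑ x : Fin d × Fin d, ∑ y : Fin d × Fin d, (U.1ᴴ * M * U.1) x (y.1, x.2) *
        ((K.trace / (d * d)) • (1 : Matrix (Fin d × Fin d) (Fin d × Fin d) ℂ)) y (x.1, y.2) =
        M.trace * K.trace / d := by
      have e3 : ∀ x : Fin d × Fin d, ∑ y : Fin d × Fin d, (U.1ᴴ * M * U.1) x (y.1, x.2) *
        ((K.trace / (d * d)) • (1 : Matrix (Fin d × Fin d) (Fin d × Fin d) ℂ)) y (x.1, y.2) =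
        (U.1ᴴ * M * U.1) x x * (K.trace / d) := by
        rintro ⟨x1, x2⟩
        rw [Fintype.sum_prod_type, Fintype.sum_eq_single x1]
        · simp
          field_simp
        · intro y1 hy1
          simp [one_apply, hy1]
      simp_rw [e3]
      rw [← Finset.sum_mul]
      change (U.1ᴴ * M * U.1).trace * _ = _
      rw [trace_mul_comm, ← Matrix.mul_assoc, hU', Matrix.one_mul, mul_div_assoc]
    rw [trace_traceSnd_mul_traceSnd, ← e2, hcard]
    simp only [e1, Matrix.sub_apply, mul_sub, Finset.sum_sub_distrib, sub_add_cancel]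
  have hsum : ∑ x : Fin d × Fin d, ∑ y : Fin d × Fin d,
      (ρ x y - ((ρ x y).trace / (d * d)) • (1 : Matrix (Fin d × Fin d) (Fin d × Fin d) ℂ)) y
        (x.1, y.2) = d ^ 3 - d := by
    have e : ∀ x y : Fin d × Fin d, (ρ x y - ((ρ x y).trace / (d * d)) •
        (1 : Matrix (Fin d × Fin d) (Fin d × Fin d) ℂ)) y (x.1, y.2) =
        (if x.2 = y.2 then 1 else 0) - (if x.1 = y.1 then ((d : ℂ) * d)⁻¹ else 0) := by
      rintro ⟨x1, x2⟩ ⟨y1, y2⟩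
      by_cases h1 : x1 = y1
      · subst h1
        simp [ρ, single_apply]
      · have h2 : ¬ (y1, x2) = (x1, x2) := by simpa using Ne.symm h1
        have h3 : ¬ (y1, y2) = (x1, y2) := by simpa using Ne.symm h1
        simp [ρ, single_apply, h1, h3, one_apply]
    simp only [e, Finset.sum_sub_distrib, Fintype.sum_prod_type]
    simp
    field_simp
  simp_rw [hU]
  rw [Finset.sum_add_distrib, mul_add, Finset.sum_comm, Finset.mul_sum]
  simp_rw [Finset.sum_comm (s := 𝒰), Finset.mul_sum (s := (Finset.univ : Finset (Fin d × Fin d))),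
    h𝒰.average, ← Finset.mul_sum, hcard, hsum]
  rw [Finset.sum_const, nsmul_eq_mul, inv_mul_cancel_left₀ h𝒰.card_ne_zero]
  rw [show ((d : ℂ) * d) ^ 2 - 1 = ((d : ℂ) ^ 2 - 1) * ((d : ℂ) ^ 2 + 1) by ring]
  field_simp
  ring

end Twirl

/-! ### The conditional entropy of order 1/2 -/

section Entropy

/-- The partial trace over the first factor. -/
def traceFst {A B : Type*} [Fintype A] (X : Matrix (A × B) (A × B) ℂ) : Matrix B B ℂ :=
  of fun i j => ∑ a, X (a, i) (a, j)

variable {A B : Type*} [Fintype A] [Fintype B]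

theorem posSemidef_traceFst {A B : Type*} [Fintype A] {X : Matrix (A × B) (A × B) ℂ}
    (hX : X.PosSemidef) : (traceFst X).PosSemidef := by
  have h : traceFst X = ∑ a, X.submatrix (Prod.mk a) (Prod.mk a) := by
    ext i j
    simp [traceFst, Matrix.sum_apply]
  rw [h]
  exact posSemidef_sum _ fun a _ => hX.submatrix _

theorem trace_mul_one_kronecker [DecidableEq A] (X : Matrix (A × B) (A × B) ℂ) (τ : Matrix B B ℂ) :
    (X * ((1 : Matrix A A ℂ) ⊗ₖ τ)).trace = (traceFst X * τ).trace := by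
  simp only [Matrix.trace, diag_apply, mul_apply, kroneckerMap_apply, Fintype.sum_prod_type,
    one_apply, traceFst, of_apply, ite_mul, one_mul, zero_mul, mul_ite, mul_zero, Finset.sum_mul]
  rw [Finset.sum_comm]
  refine Finset.sum_congr rfl fun b _ => ?_
  rw [Finset.sum_comm (s := Finset.univ (α := B))]
  refine Finset.sum_congr rfl fun a _ => ?_
  rw [Fintype.sum_eq_single a fun a' ha' => by simp [ha']]
  simp

theorem trace_mul_conjTranspose_self (X : Matrix A B ℂ) :
    (X * Xᴴ).trace = ((∑ i, ∑ j, ‖X i j‖ ^ 2 : ℝ) : ℂ) := by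
  simp [Matrix.trace, mul_apply, Complex.mul_conj, Complex.normSq_eq_norm_sq]

theorem norm_sum_sq_le {ι : Type*} [Fintype ι] (z : ι → ℂ) :
    ‖∑ i, z i‖ ^ 2 ≤ Fintype.card ι * ∑ i, ‖z i‖ ^ 2 :=
  calc ‖∑ i, z i‖ ^ 2 ≤ (∑ i, ‖z i‖) ^ 2 := by gcongr; exact norm_sum_le _ _
    _ ≤ _ := by simpa using sq_sum_le_card_mul_sum_sq (s := Finset.univ) (f := fun i => ‖z i‖)

theorem sum_norm_traceFst_le (X : Matrix (A × B) (A × B) ℂ) :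
    ∑ i, ∑ j, ‖traceFst X i j‖ ^ 2 ≤ Fintype.card A * ∑ p, ∑ q, ‖X p q‖ ^ 2 := by
  calc ∑ i, ∑ j, ‖traceFst X i j‖ ^ 2
      ≤ ∑ i, ∑ j, Fintype.card A * ∑ a, ‖X (a, i) (a, j)‖ ^ 2 := by
        gcongr with i _ j _
        exact norm_sum_sq_le _
    _ = Fintype.card A * ∑ a, ∑ i, ∑ j, ‖X (a, i) (a, j)‖ ^ 2 := by
        simp_rw [← Finset.mul_sum]
        congr 1
        rw [Finset.sum_comm (s := Finset.univ (α := A))]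
        exact Finset.sum_congr rfl fun i _ => Finset.sum_comm
    _ ≤ _ := by
        rw [Fintype.sum_prod_type]
        gcongr with a _ i _
        rw [Fintype.sum_prod_type]
        exact Finset.single_le_sum (f := fun a' => ∑ j, ‖X (a, i) (a', j)‖ ^ 2)
          (fun a' _ => by positivity) (Finset.mem_univ a)

theorem trace_traceFst_mul_self_le {S : Matrix (A × B) (A × B) ℂ} (hS : S.PosSemidef) :
    (traceFst S * traceFst S).trace.re ≤ Fintype.card A * (S * S).trace.re := by
  have h1 := trace_mul_conjTranspose_self (traceFst S)
  have h2 := trace_mul_conjTranspose_self S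
  rw [(posSemidef_traceFst hS).isHermitian.eq] at h1
  rw [hS.isHermitian.eq] at h2
  rw [h1, h2, Complex.ofReal_re, Complex.ofReal_re]
  exact sum_norm_traceFst_le S

theorem trace_conjTranspose_mul_self_sq (X : Matrix A B ℂ) :
    (Xᴴ * X * (Xᴴ * X)).trace = (X * Xᴴ * (X * Xᴴ)ᴴ).trace := by
  rw [conjTranspose_mul, conjTranspose_conjTranspose, Matrix.mul_assoc, trace_mul_comm,
    ← Matrix.mul_assoc, ← Matrix.mul_assoc]

/-- For positive semidefinite `S`, the bound `tr S² ≤ |A| tr (tr_A S)²`. With `S = Lᴴ L`, regard `L`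
as a matrix `L'` from `B` to the other indices: then `tr_A S = L'ᴴ L'`, while `L Lᴴ` is a partial
trace of `L' L'ᴴ`, so that this is `sum_norm_traceFst_le` for `L' L'ᴴ`. -/
theorem trace_mul_self_le {S : Matrix (A × B) (A × B) ℂ} (hS : S.PosSemidef) :
    (S * S).trace.re ≤ Fintype.card A * (traceFst S * traceFst S).trace.re := by
  classical
  obtain ⟨L, rfl⟩ := CStarAlgebra.nonneg_iff_eq_star_mul_self.mp hS.nonneg
  rw [star_eq_conjTranspose]
  let L' : Matrix (A × (A × B)) B ℂ := of fun p b => L p.2 (p.1, b)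
  have hT : traceFst (Lᴴ * L) = L'ᴴ * L' := by
    ext b b'
    simp [traceFst, mul_apply, L', Fintype.sum_prod_type]
  have hG : traceFst (L' * L'ᴴ) = L * Lᴴ := by
    ext r s
    simp [traceFst, mul_apply, L', Fintype.sum_prod_type]
  rw [hT, trace_conjTranspose_mul_self_sq, trace_conjTranspose_mul_self_sq,
    trace_mul_conjTranspose_self, trace_mul_conjTranspose_self, Complex.ofReal_re,
    Complex.ofReal_re, ← hG]
  exact sum_norm_traceFst_le _

/-- The Cauchy-Schwarz inequality `tr (T τ) ≤ ‖T‖₂ ‖τ‖₂` for Hermitian `T` and `τ`, with `‖T‖₂ = t`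
and `‖τ‖₂ = 1`. -/
theorem re_trace_mul_le {T τ : Matrix B B ℂ} (hT : T.IsHermitian) (hτ : τ.IsHermitian)
    (hτ1 : (τ * τ).trace = 1) {t : ℝ} (ht : 0 < t) (hT1 : (T * T).trace = ((t ^ 2 : ℝ) : ℂ)) :
    (T * τ).trace.re ≤ t := by
  have h := trace_mul_conjTranspose_self (T - (t : ℂ) • τ)
  have h0 : 0 ≤ ((T - (t : ℂ) • τ) * (T - (t : ℂ) • τ)ᴴ).trace.re := by
    rw [h, Complex.ofReal_re]; positivity
  rw [conjTranspose_sub, conjTranspose_smul, hT.eq, hτ.eq] at h0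
  simp only [Complex.star_def, Complex.conj_ofReal, sub_mul, mul_sub, Matrix.smul_mul,
    Matrix.mul_smul, trace_sub, trace_smul, smul_eq_mul, hτ1, hT1, trace_mul_comm τ T] at h0
  simp only [mul_one, Complex.sub_re, Complex.re_ofReal_mul, Complex.ofReal_re] at h0
  nlinarith

/-- The supremum in `petzRenyiHalf` is the Hilbert-Schmidt norm of `T = tr_A √ρ`: it is bounded by
Cauchy-Schwarz and attained at `σ = T² / tr T²`. The hypothesis `0 < r` excludes the junk value
`logb d 0`. -/
theorem rpow_petzRenyiHalf [DecidableEq A] [DecidableEq B] {d : ℕ} (hd : 2 ≤ d)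
    (ρ : Matrix (A × B) (A × B) ℂ) {r : ℝ} (hr : 0 < r)
    (h : (traceFst (CFC.sqrt ρ) * traceFst (CFC.sqrt ρ)).trace = (r : ℂ)) :
    (d : ℝ) ^ petzRenyiHalf d ρ = r := by
  set T := traceFst (CFC.sqrt ρ) with hTdef
  have hT : T.PosSemidef :=
    posSemidef_traceFst (Matrix.nonneg_iff_posSemidef.mp (CFC.sqrt_nonneg ρ))
  have ht : 0 < Real.sqrt r := Real.sqrt_pos.mpr hr
  have hsup : (⨆ σ : {σ : Matrix B B ℂ // IsState σ},
      ((CFC.sqrt ρ * ((1 : Matrix A A ℂ) ⊗ₖ CFC.sqrt σ.1)).trace).re) = Real.sqrt r := by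
    have hle : ∀ σ : {σ : Matrix B B ℂ // IsState σ},
        ((CFC.sqrt ρ * ((1 : Matrix A A ℂ) ⊗ₖ CFC.sqrt σ.1)).trace).re ≤ Real.sqrt r := by
      rintro ⟨σ, hσ, hσ1⟩
      rw [trace_mul_one_kronecker]
      refine re_trace_mul_le hT.isHermitian
        (Matrix.nonneg_iff_posSemidef.mp (CFC.sqrt_nonneg σ)).isHermitian ?_ ht ?_
      · rw [CFC.sqrt_mul_sqrt_self σ hσ.nonneg, hσ1]
      · rw [Real.sq_sqrt hr.le, h]
    let τ : Matrix B B ℂ := (((Real.sqrt r)⁻¹ : ℝ) : ℂ) • T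
    have hτ : τ.PosSemidef := hT.smul (by exact_mod_cast (inv_pos.mpr ht).le)
    have hττ : IsState (τ * τ) := by
      refine ⟨?_, ?_⟩
      · have := posSemidef_conjTranspose_mul_self τ
        rwa [hτ.isHermitian.eq] at this
      · simp only [τ, Matrix.smul_mul, Matrix.mul_smul, trace_smul, h, smul_eq_mul]
        norm_cast
        rw [← mul_assoc, ← mul_inv, Real.mul_self_sqrt hr.le, inv_mul_cancel₀ hr.ne']
    have hsq : CFC.sqrt (τ * τ) = τ := CFC.sqrt_unique rfl hτ.nonneg
    have : Nonempty {σ : Matrix B B ℂ // IsState σ} := ⟨⟨_, hττ⟩⟩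
    refine le_antisymm (ciSup_le hle) ?_
    refine le_trans (le_of_eq ?_) (le_ciSup ⟨_, Set.forall_mem_range.mpr hle⟩ ⟨_, hττ⟩)
    rw [trace_mul_one_kronecker, hsq, Matrix.mul_smul, trace_smul, h, smul_eq_mul,
      ← Complex.ofReal_mul, Complex.ofReal_re, inv_mul_eq_div, Real.div_sqrt]
  have hd0 : (0 : ℝ) < d := by positivity
  have hd1 : (d : ℝ) ≠ 1 := by exact_mod_cast (by omega : d ≠ 1)
  rw [petzRenyiHalf, hsup, mul_comm, Real.rpow_mul hd0.le, Real.rpow_logb hd0 hd1 ht]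
  norm_num
  exact Real.sq_sqrt hr.le

end Entropy

/-! ### The good channel -/

section GoodState

variable {A B : Type*} [Fintype A] [Fintype B]

/-- Two copies `X ⊗ X` of an operator on `A × B`, with the two copies of `A` collected in the first
factor and those of `B` in the second. -/
def collectTwo (X : Matrix (A × B) (A × B) ℂ) :
    Matrix ((A × A) × (B × B)) ((A × A) × (B × B)) ℂ :=
  (X ⊗ₖ X).submatrix (Equiv.prodProdProdComm A A B B) (Equiv.prodProdProdComm A A B B)

/-- The systems `A₂ (A₁ B₁ B₂)`, in the order that the good channel produces, regrouped as
`(A₁ A₂) (B₁ B₂)`. -/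
def regroup (A B : Type*) : A × (A × B × B) ≃ (A × A) × (B × B) where
  toFun x := ((x.2.1, x.1), x.2.2)
  invFun x := (x.1.2, (x.1.1, x.2))
  left_inv _ := rfl
  right_inv _ := rfl

/-- Two copies of `X`, conjugated by `Cᵀ` on the two copies of `A`. For `X` the state of a channel
and an EPR pair, this is the corresponding state of the good channel, see
`choiState_goodChannel`. -/
def goodLift [DecidableEq B] (C : Matrix (A × A) (A × A) ℂ)
    (X : Matrix (A × B) (A × B) ℂ) :
    Matrix (A × (A × B × B)) (A × (A × B × B)) ℂ :=
  ((Cᵀ ⊗ₖ (1 : Matrix (B × B) (B × B) ℂ)) * collectTwo X *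
    (Cᵀ ⊗ₖ (1 : Matrix (B × B) (B × B) ℂ))ᴴ).submatrix (regroup A B) (regroup A B)

theorem goodLift_apply [DecidableEq B] (C : Matrix (A × A) (A × A) ℂ)
    (X : Matrix (A × B) (A × B) ℂ)
    (x y : A × (A × B × B)) :
    goodLift C X x y = ∑ p : A × A, ∑ q : A × A, C p (x.2.1, x.1) * star (C q (y.2.1, y.1)) *
      (X (p.1, x.2.2.1) (q.1, y.2.2.1) * X (p.2, x.2.2.2) (q.2, y.2.2.2)) := by
  obtain ⟨a2, a1, β⟩ := x
  obtain ⟨a2', a1', β'⟩ := y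
  have h1 : ∀ q', ((Cᵀ ⊗ₖ (1 : Matrix (B × B) (B × B) ℂ)) * collectTwo X) ((a1, a2), β) q' =
      ∑ p, C p (a1, a2) * collectTwo X (p, β) q' := by
    intro q'
    rw [mul_apply, Fintype.sum_prod_type]
    refine Finset.sum_congr rfl fun p _ => ?_
    rw [Fintype.sum_eq_single β fun b hb => by simp [one_apply, hb.symm]]
    simp
  change ((Cᵀ ⊗ₖ (1 : Matrix (B × B) (B × B) ℂ)) * collectTwo X *
    (Cᵀ ⊗ₖ (1 : Matrix (B × B) (B × B) ℂ))ᴴ) ((a1, a2), β) ((a1', a2'), β') = _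
  rw [mul_apply, Fintype.sum_prod_type, Finset.sum_comm (s := Finset.univ (α := A × A)),
    Fintype.sum_eq_single β' fun b hb => by simp [one_apply, hb.symm], Finset.sum_comm]
  refine Finset.sum_congr rfl fun q _ => ?_
  rw [h1, Finset.sum_mul]
  refine Finset.sum_congr rfl fun p _ => ?_
  simp [collectTwo]
  ring

theorem conjTranspose_transpose_kronecker_one_mul_self [DecidableEq A] [DecidableEq B]
    {C : Matrix (A × A) (A × A) ℂ} (hC : C ∈ unitaryGroup (A × A) ℂ) :
    (Cᵀ ⊗ₖ (1 : Matrix (B × B) (B × B) ℂ))ᴴ * (Cᵀ ⊗ₖ (1 : Matrix (B × B) (B × B) ℂ)) = 1 := by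
  have : Cᵀᴴ * Cᵀ = 1 := by
    change Cᴴᵀ * Cᵀ = 1
    rw [← transpose_mul, ← star_eq_conjTranspose, mem_unitaryGroup_iff.mp hC, transpose_one]
  rw [conjTranspose_kronecker, ← mul_kronecker_mul, this]
  simp

theorem goodLift_mul [DecidableEq A] [DecidableEq B]
    {C : Matrix (A × A) (A × A) ℂ} (hC : C ∈ unitaryGroup (A × A) ℂ)
    (X Y : Matrix (A × B) (A × B) ℂ) : goodLift C X * goodLift C Y = goodLift C (X * Y) := by
  have h1 := conjTranspose_transpose_kronecker_one_mul_self (B := B) hC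
  have h2 : collectTwo X * collectTwo Y = collectTwo (X * Y) := by
    rw [collectTwo, collectTwo, submatrix_mul_equiv, ← mul_kronecker_mul]
    rfl
  rw [goodLift, goodLift, submatrix_mul_equiv, goodLift, ← h2]
  congr 1
  generalize Cᵀ ⊗ₖ (1 : Matrix (B × B) (B × B) ℂ) = Z at h1
  calc Z * collectTwo X * Zᴴ * (Z * collectTwo Y * Zᴴ)
      = Z * collectTwo X * (Zᴴ * Z) * collectTwo Y * Zᴴ := by simp only [Matrix.mul_assoc]
    _ = _ := by rw [h1, Matrix.mul_one, Matrix.mul_assoc Z]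

theorem posSemidef_goodLift [DecidableEq B] (C : Matrix (A × A) (A × A) ℂ)
    {X : Matrix (A × B) (A × B) ℂ}
    (hX : X.PosSemidef) : (goodLift C X).PosSemidef :=
  (((hX.kronecker hX).submatrix _).mul_mul_conjTranspose_same _).submatrix _

theorem sqrt_goodLift [DecidableEq A] [DecidableEq B]
    {C : Matrix (A × A) (A × A) ℂ} (hC : C ∈ unitaryGroup (A × A) ℂ)
    {X : Matrix (A × B) (A × B) ℂ} (hX : X.PosSemidef) :
    CFC.sqrt (goodLift C X) = goodLift C (CFC.sqrt X) := by
  refine CFC.sqrt_unique ?_ (posSemidef_goodLift C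
    (Matrix.nonneg_iff_posSemidef.mp (CFC.sqrt_nonneg X))).nonneg
  rw [goodLift_mul hC, CFC.sqrt_mul_sqrt_self X hX.nonneg]

theorem trace_goodLift [DecidableEq A] [DecidableEq B]
    {C : Matrix (A × A) (A × A) ℂ} (hC : C ∈ unitaryGroup (A × A) ℂ)
    (X : Matrix (A × B) (A × B) ℂ) : (goodLift C X).trace = X.trace ^ 2 := by
  have h1 := conjTranspose_transpose_kronecker_one_mul_self (B := B) hC
  have tr_sub : ∀ {m n : Type _} [Fintype m] [Fintype n] (e : m ≃ n) (M : Matrix n n ℂ),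
      (M.submatrix e e).trace = M.trace := fun e M => e.sum_comp fun i => M i i
  rw [goodLift, tr_sub, trace_mul_comm, ← Matrix.mul_assoc, h1, Matrix.one_mul, collectTwo, tr_sub,
    trace_kronecker, sq]

/-- The block of `X ⊗ X` at the pair `β β'` of indices of the two copies of `B`. It is transposed,
which turns conjugation by `Cᵀ` in `goodLift` into `X ↦ Cᴴ X C`. -/
def block (X : Matrix (A × B) (A × B) ℂ) (β β' : B × B) : Matrix (A × A) (A × A) ℂ :=
  of fun q p => X (p.1, β.1) (q.1, β'.1) * X (p.2, β.2) (q.2, β'.2)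

theorem traceFst_goodLift_apply [DecidableEq B] (C : Matrix (A × A) (A × A) ℂ)
    (X : Matrix (A × B) (A × B) ℂ)
    (a a' : A) (β β' : B × B) :
    traceFst (goodLift C X) (a, β) (a', β') = traceSnd (Cᴴ * block X β β' * C) a' a := by
  simp only [traceFst, traceSnd, of_apply, goodLift_apply]
  refine Finset.sum_congr rfl fun k _ => ?_
  simp only [mul_apply, Finset.sum_mul, block, of_apply, conjTranspose_apply]
  exact Finset.sum_congr rfl fun p _ => Finset.sum_congr rfl fun q _ => by ring

theorem trace_traceFst_goodLift_mul_self [DecidableEq B] (C : Matrix (A × A) (A × A) ℂ)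
    (X : Matrix (A × B) (A × B) ℂ) :
    (traceFst (goodLift C X) * traceFst (goodLift C X)).trace =
      ∑ β : B × B, ∑ β' : B × B,
        (traceSnd (Cᴴ * block X β β' * C) * traceSnd (Cᴴ * block X β' β * C)).trace := by
  have h : ∀ (a : A) (β : B × B), (traceFst (goodLift C X) * traceFst (goodLift C X)) (a, β) (a, β)
      = ∑ a', ∑ β', traceSnd (Cᴴ * block X β β' * C) a' a *
        traceSnd (Cᴴ * block X β' β * C) a a' := by
    intro a β
    rw [mul_apply, Fintype.sum_prod_type]
    simp only [traceFst_goodLift_apply]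
  rw [Matrix.trace, Fintype.sum_prod_type, Finset.sum_comm]
  refine Finset.sum_congr rfl fun β _ => ?_
  simp only [diag_apply, h, Matrix.trace]
  simp only [mul_apply]
  rw [Finset.sum_comm]
  conv_rhs => rw [Finset.sum_comm]
  refine Finset.sum_congr rfl fun a' _ => ?_
  rw [Finset.sum_comm]

theorem sum_trace_block_mul_block (X : Matrix (A × B) (A × B) ℂ) :
    ∑ β : B × B, ∑ β' : B × B, (block X β β' * block X β' β).trace = (X * X).trace ^ 2 := by
  have h : (X * X).trace ^ 2 = (collectTwo X * collectTwo X).trace := by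
    rw [collectTwo, submatrix_mul_equiv, ← mul_kronecker_mul, sq, ← trace_kronecker]
    exact ((Equiv.prodProdProdComm A A B B).sum_comp fun i => ((X * X) ⊗ₖ (X * X)) i i).symm
  rw [h]
  conv_rhs => rw [Matrix.trace, Fintype.sum_prod_type, Finset.sum_comm]
  refine Finset.sum_congr rfl fun β _ => ?_
  have e : ∀ p : A × A, (collectTwo X * collectTwo X) (p, β) (p, β) =
      ∑ q, ∑ β', block X β β' q p * block X β' β p q := by
    intro p
    rw [mul_apply, Fintype.sum_prod_type]
    rfl
  simp only [diag_apply, e, Matrix.trace, mul_apply]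
  rw [Finset.sum_comm]
  conv_rhs => rw [Finset.sum_comm]
  refine Finset.sum_congr rfl fun q _ => ?_
  rw [Finset.sum_comm]

theorem sum_trace_block_mul_trace_block (X : Matrix (A × B) (A × B) ℂ) :
    ∑ β : B × B, ∑ β' : B × B, (block X β β').trace * (block X β' β).trace =
      (traceFst X * traceFst X).trace ^ 2 := by
  have h : ∀ β β' : B × B, (block X β β').trace = (traceFst X ⊗ₖ traceFst X) β β' := by
    intro β β'
    simp only [Matrix.trace, diag_apply, block, of_apply, kroneckerMap_apply, traceFst,
      Fintype.sum_prod_type, Finset.sum_mul_sum]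
  rw [sq, ← trace_kronecker, mul_kronecker_mul, Matrix.trace]
  simp only [h, diag_apply, mul_apply]

end GoodState

/-- The state `(id ⊗ W)(Φ)`, for `Φ` the EPR pair, in terms of its blocks `W(E_ij) / d`. -/
noncomputable def choiState {d : ℕ} {B : Type*} (W : Matrix (Fin d) (Fin d) ℂ →ₗ[ℂ] Matrix B B ℂ) :
    Matrix (Fin d × B) (Fin d × B) ℂ :=
  of fun x y => (d : ℂ)⁻¹ * W (single x.1 y.1 1) x.2 y.2

section Choi

variable {d : ℕ} {B : Type*}

theorem epr_apply (p q : Fin d × Fin d) :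
    epr d p q = if p.1 = p.2 ∧ q.1 = q.2 then (d : ℂ)⁻¹ else 0 := by
  have h : ((Real.sqrt d : ℂ))⁻¹ * ((Real.sqrt d : ℂ))⁻¹ = (d : ℂ)⁻¹ := by
    rw [← mul_inv, ← Complex.ofReal_mul, Real.mul_self_sqrt (Nat.cast_nonneg d)]
    simp
  by_cases h1 : p.1 = p.2 <;> by_cases h2 : q.1 = q.2 <;>
    simp [epr, vecMulVec_apply, eprVector, h1, h2, h]

theorem tensorMap_id_apply {K A' B' : Type*} [Fintype K] [DecidableEq K] [Fintype A']
    [DecidableEq A'] (F : Matrix A' A' ℂ →ₗ[ℂ] Matrix B' B' ℂ) (Z : Matrix (K × A') (K × A') ℂ)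
    (x y : K × B') :
    tensorMap (LinearMap.id : Matrix K K ℂ →ₗ[ℂ] Matrix K K ℂ) F Z x y =
      ∑ p, ∑ q, Z (x.1, p) (y.1, q) * F (single p q 1) x.2 y.2 := by
  obtain ⟨i, b⟩ := x
  obtain ⟨j, b'⟩ := y
  simp only [tensorMap, LinearMap.coe_mk, AddHom.coe_mk, LinearMap.id_apply, Matrix.sum_apply,
    Matrix.smul_apply, kroneckerMap_apply, smul_eq_mul, single_apply, Fintype.sum_prod_type]
  rw [Fintype.sum_eq_single i fun i' hi' => by simp [hi']]
  refine Finset.sum_congr rfl fun p _ => ?_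
  rw [Fintype.sum_eq_single j fun j' hj' => by simp [hj']]
  simp

theorem tensorMap_id_epr (W : Matrix (Fin d) (Fin d) ℂ →ₗ[ℂ] Matrix B B ℂ) :
    tensorMap (LinearMap.id : Matrix (Fin d) (Fin d) ℂ →ₗ[ℂ] Matrix (Fin d) (Fin d) ℂ) W (epr d) =
      choiState W := by
  ext x y
  rw [tensorMap_id_apply, Fintype.sum_eq_single x.1 fun p hp => by simp [epr_apply, hp.symm],
    Fintype.sum_eq_single y.1 fun p hp => by simp [epr_apply, hp.symm]]
  simp [epr_apply, choiState]

theorem posSemidef_choiState [Fintype B] {W : Matrix (Fin d) (Fin d) ℂ →ₗ[ℂ] Matrix B B ℂ}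
    (hW : IsChannel W) : (choiState W).PosSemidef := by
  rw [← tensorMap_id_epr]
  exact hW.1 d _ (posSemidef_vecMulVec_self_star _)

theorem trace_choiState [Fintype B] (hd : d ≠ 0)
    {W : Matrix (Fin d) (Fin d) ℂ →ₗ[ℂ] Matrix B B ℂ} (hW : IsChannel W) :
    (choiState W).trace = 1 := by
  have h : ∀ a : Fin d, ∑ b, W (single a a 1) b b = 1 := fun a => by
    have := hW.2 (single a a 1)
    rwa [trace_single_eq_same] at this
  simp [Matrix.trace, choiState, Fintype.sum_prod_type, ← Finset.mul_sum, h, hd]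

/-- The Rényi-Bhattacharyya parameter is `tr (tr_A √ρ)²`, and it lies between `1 / d` and `d`. -/
theorem renyiBhattacharyya_eq [Fintype B] [DecidableEq B] (hd : 2 ≤ d)
    (V : Matrix (Fin d) (Fin d) ℂ →ₗ[ℂ] Matrix B B ℂ) (hV : (choiState V).PosSemidef)
    (hV1 : (choiState V).trace = 1) :
    (renyiBhattacharyya V : ℂ) =
        (traceFst (CFC.sqrt (choiState V)) * traceFst (CFC.sqrt (choiState V))).trace ∧
      1 / (d : ℝ) ≤ renyiBhattacharyya V ∧ renyiBhattacharyya V ≤ d := by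
  have hS : (CFC.sqrt (choiState V)).PosSemidef :=
    Matrix.nonneg_iff_posSemidef.mp (CFC.sqrt_nonneg _)
  have hSS : (CFC.sqrt (choiState V) * CFC.sqrt (choiState V)).trace.re = 1 := by
    rw [CFC.sqrt_mul_sqrt_self _ hV.nonneg, hV1, Complex.one_re]
  have hd0 : (0 : ℝ) < d := by positivity
  have h1 := trace_mul_self_le hS
  have h2 := trace_traceFst_mul_self_le hS
  have h3 := trace_mul_conjTranspose_self (traceFst (CFC.sqrt (choiState V)))
  rw [(posSemidef_traceFst hS).isHermitian.eq] at h3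
  rw [hSS, Fintype.card_fin] at h1 h2
  set t := (traceFst (CFC.sqrt (choiState V)) * traceFst (CFC.sqrt (choiState V))).trace with ht
  have hre : t = (t.re : ℂ) := by rw [h3, Complex.ofReal_re]
  have hlow : 1 / (d : ℝ) ≤ t.re := by rwa [div_le_iff₀' hd0]
  have hR : renyiBhattacharyya V = t.re := by
    rw [renyiBhattacharyya, tensorMap_id_epr]
    exact rpow_petzRenyiHalf hd _ ((by positivity : 0 < 1 / (d : ℝ)).trans_le hlow) hre
  rw [hR]
  exact ⟨hre.symm, hlow, by linarith⟩

/-- As `(1 ⊗ C)|Φ⟩ = (Cᵀ ⊗ 1)|Φ⟩` for the maximally entangled vector of two copies, `C` may be moved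
past the channels to the reference systems `A₁ A₂`. -/
theorem choiState_goodChannel [Fintype B] [DecidableEq B]
    (W : Matrix (Fin d) (Fin d) ℂ →ₗ[ℂ] Matrix B B ℂ)
    (C : Matrix (Fin d × Fin d) (Fin d × Fin d) ℂ) :
    choiState (goodChannel W C) = goodLift C (choiState W) := by
  ext ⟨a2, a1, b1, b2⟩ ⟨a2', a1', b1', b2'⟩
  have hWW : ∀ p q : Fin d × Fin d, tensorMap W W (single p q 1) =
      W (single p.1 q.1 1) ⊗ₖ W (single p.2 q.2 1) := by
    intro p q
    simp only [tensorMap, LinearMap.coe_mk, AddHom.coe_mk]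
    rw [Fintype.sum_eq_single p fun p' hp' => by simp [hp'.symm],
      Fintype.sum_eq_single q fun q' hq' => by simp [hq'.symm]]
    simp
  have hΩ : ∀ p q : Fin d × Fin d, (((1 : Matrix (Fin d) (Fin d) ℂ) ⊗ₖ C) *
      Matrix.reindex (Equiv.prodAssoc _ _ _) (Equiv.prodAssoc _ _ _)
        (epr d ⊗ₖ single a2 a2' (1 : ℂ)) *
      ((1 : Matrix (Fin d) (Fin d) ℂ) ⊗ₖ C).conjTranspose) (a1, p) (a1', q) =
      (d : ℂ)⁻¹ * (C p (a1, a2) * star (C q (a1', a2'))) := by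
    intro p q
    have e1 : ∀ z, (((1 : Matrix (Fin d) (Fin d) ℂ) ⊗ₖ C) *
        Matrix.reindex (Equiv.prodAssoc _ _ _) (Equiv.prodAssoc _ _ _)
        (epr d ⊗ₖ single a2 a2' (1 : ℂ))) (a1, p) z =
        C p (a1, a2) * if z.1 = z.2.1 ∧ z.2.2 = a2' then (d : ℂ)⁻¹ else 0 := by
      intro z
      rw [mul_apply, Fintype.sum_prod_type,
        Fintype.sum_eq_single a1 fun a ha => by simp [one_apply, ha.symm],
        Fintype.sum_eq_single (a1, a2)]
      · simp [epr_apply, single_apply, ← ite_and, and_comm, eq_comm]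
      · rintro ⟨s1, s2⟩ hs
        by_cases h1 : a1 = s1
        · subst h1
          have h2 : a2 ≠ s2 := fun h => hs (by rw [h])
          simp [h2]
        · simp [epr_apply, h1]
    rw [mul_apply, Fintype.sum_prod_type,
      Fintype.sum_eq_single a1' fun a ha => by simp [one_apply, ha.symm],
      Fintype.sum_eq_single (a1', a2')]
    · rw [e1]
      simp
      ring
    · rintro ⟨s1, s2⟩ hs
      rw [e1]
      have h2 : ¬ (a1' = s1 ∧ s2 = a2') := fun h => hs (by rw [h.1, h.2])
      simp [h2]
  rw [goodLift_apply]
  change (d : ℂ)⁻¹ * tensorMap LinearMap.id (tensorMap W W) _ _ _ = _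
  rw [tensorMap_id_apply, Finset.mul_sum]
  refine Finset.sum_congr rfl fun p _ => ?_
  rw [Finset.mul_sum]
  refine Finset.sum_congr rfl fun q _ => ?_
  rw [hΩ, hWW]
  simp only [kroneckerMap_apply, choiState, of_apply]
  ring

end Choi

end QuantumPolar

theorem lemma2 (d : ℕ) (hd : 2 ≤ d) {B : Type*} [Fintype B] [DecidableEq B]
    (W : Matrix (Fin d) (Fin d) ℂ →ₗ[ℂ] Matrix B B ℂ) (hW : IsChannel W)
    (𝒰 : Finset (Matrix.unitaryGroup (Fin d × Fin d) ℂ)) (h𝒰 : IsUnitaryTwoDesign 𝒰) :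
    (𝒰.card : ℝ)⁻¹ * ∑ C ∈ 𝒰, renyiBhattacharyya (goodChannel W C) =
        (d : ℝ) / ((d : ℝ) ^ 2 + 1) * (1 + renyiBhattacharyya W ^ 2) ∧
      (d : ℝ) / ((d : ℝ) ^ 2 + 1) * (1 + renyiBhattacharyya W ^ 2) ≤ renyiBhattacharyya W ∧
      ((d : ℝ) / ((d : ℝ) ^ 2 + 1) * (1 + renyiBhattacharyya W ^ 2) = renyiBhattacharyya W ↔
        renyiBhattacharyya W = 1 / (d : ℝ) ∨ renyiBhattacharyya W = (d : ℝ)) := by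
  have hd0 : (0 : ℝ) < d := by positivity
  have hρ := posSemidef_choiState hW
  have hρ1 := trace_choiState (by omega) hW
  obtain ⟨hR, hlow, hupp⟩ := renyiBhattacharyya_eq hd W hρ hρ1
  have hgood : ∀ C : Matrix.unitaryGroup (Fin d × Fin d) ℂ,
      (renyiBhattacharyya (goodChannel W C.1) : ℂ) =
        ∑ β : B × B, ∑ β' : B × B,
          (traceSnd (C.1.conjTranspose * block (CFC.sqrt (choiState W)) β β' * C.1) *
            traceSnd (C.1.conjTranspose * block (CFC.sqrt (choiState W)) β' β * C.1)).trace := by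
    intro C
    have h := choiState_goodChannel W C.1
    rw [(renyiBhattacharyya_eq hd (goodChannel W C.1)
      (by rw [h]; exact posSemidef_goodLift _ hρ)
      (by rw [h, trace_goodLift C.2, hρ1, one_pow])).1, h, sqrt_goodLift C.2 hρ,
      trace_traceFst_goodLift_mul_self]
  -- The inequality and its equality case are read off from this quadratic with roots `1 / d`, `d`.
  have hfactor : (d : ℝ) / ((d : ℝ) ^ 2 + 1) * (1 + renyiBhattacharyya W ^ 2) -
      renyiBhattacharyya W = (d * renyiBhattacharyya W - 1) * (renyiBhattacharyya W - d) /
        ((d : ℝ) ^ 2 + 1) := by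
    field_simp
    ring
  refine ⟨?_, ?_, ?_⟩
  · rw [← Complex.ofReal_inj]
    push_cast
    simp_rw [hgood]
    rw [Finset.sum_comm]
    simp_rw [Finset.sum_comm (s := 𝒰), Finset.mul_sum (s := (Finset.univ : Finset (B × B))),
      h𝒰.average_trace_traceSnd hd, ← Finset.mul_sum, Finset.sum_add_distrib]
    rw [sum_trace_block_mul_block, sum_trace_block_mul_trace_block, ← hR,
      CFC.sqrt_mul_sqrt_self _ hρ.nonneg, hρ1, one_pow]
  · rw [← sub_nonpos, hfactor]
    rw [div_le_iff₀' hd0] at hlow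
    exact div_nonpos_of_nonpos_of_nonneg
      (mul_nonpos_of_nonneg_of_nonpos (by linarith) (by linarith)) (by positivity)
  · rw [← sub_eq_zero, hfactor, div_eq_zero_iff, or_iff_left (by positivity), mul_eq_zero,
      sub_eq_zero, sub_eq_zero, eq_div_iff hd0.ne', mul_comm]
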